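/- Let $d\in\mathbb{N}$ and let $M_d$ be the algebra of complex $d\times d$ matrices. Let $(\phi_t)_{t\geq 0}$ be a one-parameter semigroup of linear maps on $M_d$, i.e. $\phi_0=\mathrm{id}$ and $\phi_{s+t}=\phi_s\circ\phi_t$ for all $s,t\geq 0$, such that every $\phi_t$ is completely positive, unital ($\phi_t(I)=I$) and trace preserving. A linear map $\phi:M_d\to M_d$ is called PPT if both $\phi$ and $\theta\circ\phi$ are completely positive, where $\theta$ is the transposition; a PPT map $\phi$ is called entanglement breaking if its Choi matrix is separable, i.e. $\sum_{i,j=1}^d E_{ij}\otimes\phi(E_{ij})=\sum_k A_k\otimes B_k$ for finitely many positive semidefinite $A_k,B_k\in M_d$, where the $E_{ij}$ are the matrix units. If there exists $s>0$ such that $\phi_s$ is PPT, then the semigroup is eventually entanglement breaking: there exists $t_0>0$ such that $\phi_t$ is entanglement breaking for all $t\geq t_0$. -/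

import Mathlib

open scoped NNReal Kronecker ComplexOrder

namespace QuantumMaps

/-- The algebra `M_d` of complex `d × d` matrices. -/
abbrev Mat (d : ℕ) : Type := Matrix (Fin d) (Fin d) ℂ

open scoped MatrixOrder Matrix.Norms.L2Operator in
/-- `φ` is completely positive: it underlies a completely positive map between C⋆-algebras, where
`M_d` carries the spectral norm and the order in which `0 ≤ X` means positive semidefinite. -/
def IsCP {d : ℕ} (φ : Mat d →ₗ[ℂ] Mat d) : Prop :=
  ∃ Φ : CompletelyPositiveMap (Mat d) (Mat d), Φ.toLinearMap = φ

/-- `φ` is completely copositive: transposition after `φ` is completely positive. -/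
def IsCoCP {d : ℕ} (φ : Mat d →ₗ[ℂ] Mat d) : Prop :=
  IsCP ((Matrix.transposeLinearEquiv (Fin d) (Fin d) ℂ ℂ).toLinearMap ∘ₗ φ)

/-- `φ` is a PPT map: both completely positive and completely copositive. -/
def IsPPT {d : ℕ} (φ : Mat d →ₗ[ℂ] Mat d) : Prop :=
  IsCP φ ∧ IsCoCP φ

/-- The Choi matrix `∑ i j, E_ij ⊗ φ(E_ij)`; `M_d ⊗ M_d` is realised as matrices indexed by pairs. -/
noncomputable def choi {d : ℕ} (φ : Mat d →ₗ[ℂ] Mat d) :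
    Matrix (Fin d × Fin d) (Fin d × Fin d) ℂ :=
  ∑ i, ∑ j, Matrix.single i j (1 : ℂ) ⊗ₖ φ (Matrix.single i j 1)

/-- A separable matrix: a finite sum of `A_i ⊗ B_i` with all `A_i`, `B_i` positive semidefinite. -/
def IsSeparable {d : ℕ} (X : Matrix (Fin d × Fin d) (Fin d × Fin d) ℂ) : Prop :=
  ∃ (m : ℕ) (A B : Fin m → Mat d),
    (∀ i, (A i).PosSemidef) ∧ (∀ i, (B i).PosSemidef) ∧ X = ∑ i, A i ⊗ₖ B i

/-- `φ` is entanglement breaking: a PPT map with separable Choi matrix. -/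
def IsEB {d : ℕ} (φ : Mat d →ₗ[ℂ] Mat d) : Prop :=
  IsPPT φ ∧ IsSeparable (choi φ)

/-- `φ` is unital. -/
def IsUnital {d : ℕ} (φ : Mat d →ₗ[ℂ] Mat d) : Prop :=
  φ 1 = 1

/-- `φ` is trace preserving. -/
def IsTracePreserving {d : ℕ} (φ : Mat d →ₗ[ℂ] Mat d) : Prop :=
  ∀ X : Mat d, (φ X).trace = X.trace

/-- `(φ_t)`, `t ≥ 0`, is a one-parameter semigroup of linear maps on `M_d`. -/
structure IsSemigroup {d : ℕ} (φ : ℝ≥0 → (Mat d →ₗ[ℂ] Mat d)) : Prop where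
  map_zero : φ 0 = LinearMap.id
  map_add : ∀ s t : ℝ≥0, φ (s + t) = φ s ∘ₗ φ t

/-- The family `(φ_t)` is eventually entanglement breaking. -/
def IsEventuallyEB {d : ℕ} (φ : ℝ≥0 → (Mat d →ₗ[ℂ] Mat d)) : Prop :=
  ∃ t₀ : ℝ≥0, 0 < t₀ ∧ ∀ t : ℝ≥0, t₀ ≤ t → IsEB (φ t)

end QuantumMaps

/-! For a unital, trace-preserving completely positive map, the Kadison–Schwarz defect φ(X*X) −
φ(X)*φ(X) is positive and its trace is the loss of squared Hilbert–Schmidt norm. Elements that never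
lose norm therefore lie in every multiplicative domain and form a star algebra, `stable`, on which
each φ_t is injective. A copositive φ_s also reverses products there, so the algebra is commutative
(`stable_comm`) and spanned by orthogonal projections P_i. Each φ_t permutes its finitely many
idempotents; since t can be divided by the order of the permutation group, the action is trivial
(`map_idempotent`).

Limit points of orbits are stable, so φ_t tends to X ↦ ∑ tr(P_i X)/tr(P_i) P_i (`tendsto_condExp`).
This limit can lie on the boundary of the separable cone, so convergence alone does not suffice.
Copositivity supplies the rest: φ_t(Y P_i) = φ_t(P_i Y) makes φ_t exactly block diagonal
(`map_eq_sum_compress`). In each block the limit is completely depolarising, an interior point of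
the Holevo cone among hermitian-preserving maps (`add_smul_mem_holevo`). -/

namespace QuantumMaps

variable {d : ℕ}

/-! ### Schwarz inequalities and multiplicative domains. -/

section CompletelyPositive

open scoped MatrixOrder Matrix.Norms.L2Operator

theorem _root_.exists_eq_star_mul_self_of_nonneg {A : Type*} [NonUnitalCStarAlgebra A]
    [PartialOrder A] [StarOrderedRing A] {a : A} (h : 0 ≤ a) : ∃ b, a = star b * b :=
  CStarAlgebra.nonneg_iff_eq_star_mul_self.mp h

/-- The value of a completely positive map at the block matrix `[X 1]ᴴ [X 1]` is a Gram matrix. -/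
theorem _root_.CompletelyPositiveMap.exists_gram {A : Type*} [CStarAlgebra A] [PartialOrder A]
    [StarOrderedRing A] (φ : CompletelyPositiveMap A A) (x : A) :
    ∃ a b : Fin 2 → A, φ (star x * x) = ∑ k, star (a k) * a k ∧
      φ (star x) = ∑ k, star (a k) * b k ∧ φ x = ∑ k, star (b k) * a k ∧
      φ 1 = ∑ k, star (b k) * b k := by
  -- The zero row only makes the matrix square.
  let N : CStarMatrix (Fin 2) (Fin 2) A := CStarMatrix.ofMatrix !![x, 1; 0, 0]
  have hpos := φ.map_cstarMatrix_nonneg' 2 (star N * N) (star_mul_self_nonneg N)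
  obtain ⟨G, hG⟩ := exists_eq_star_mul_self_of_nonneg hpos
  have key (i j : Fin 2) : φ (∑ k, star (N k i) * N k j) = ∑ k, star (G k i) * G k j := by
    have := congrArg (fun M : CStarMatrix (Fin 2) (Fin 2) A => M i j) hG
    simpa [CStarMatrix.mul_apply, CStarMatrix.star_apply] using! this
  refine ⟨fun k => G k 0, fun k => G k 1, ?_, ?_, ?_, ?_⟩
  · simpa [N] using key 0 0
  · simpa [N] using key 0 1
  · simpa [N] using key 1 0
  · simpa [N] using key 1 1

theorem IsCP.exists_gram {φ : Mat d →ₗ[ℂ] Mat d} (h : IsCP φ) (X : Mat d) :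
    ∃ a b : Fin 2 → Mat d, φ (star X * X) = ∑ k, star (a k) * a k ∧
      φ (star X) = ∑ k, star (a k) * b k ∧ φ X = ∑ k, star (b k) * a k ∧
      φ 1 = ∑ k, star (b k) * b k := by
  obtain ⟨Φ, rfl⟩ := h
  exact Φ.exists_gram X

theorem IsCP.map_star {φ : Mat d →ₗ[ℂ] Mat d} (h : IsCP φ) (X : Mat d) :
    φ (star X) = star (φ X) := by
  obtain ⟨a, b, -, h₁, h₂, -⟩ := h.exists_gram X
  simp [h₁, h₂]

/-- The Kadison–Schwarz inequality for unital completely positive maps. -/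
theorem IsCP.schwarz {φ : Mat d →ₗ[ℂ] Mat d} (h : IsCP φ) (h1 : IsUnital φ) (X : Mat d) :
    0 ≤ φ (star X * X) - star (φ X) * φ X := by
  obtain ⟨a, b, haa, hab, hba, hbb⟩ := h.exists_gram X
  rw [h1] at hbb
  have hab' : star (φ X) = ∑ k, star (a k) * b k := by rw [← h.map_star, hab]
  have : φ (star X * X) - star (φ X) * φ X
      = ∑ k, star (a k - b k * φ X) * (a k - b k * φ X) := by
    have e (k : Fin 2) : star (a k - b k * φ X) * (a k - b k * φ X)
        = star (a k) * a k - (star (a k) * b k) * φ X - star (φ X) * (star (b k) * a k)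
          + star (φ X) * (star (b k) * b k) * φ X := by
      simp only [star_sub, star_mul]; noncomm_ring
    simp only [e, Finset.sum_add_distrib, Finset.sum_sub_distrib, ← Finset.sum_mul,
      ← Finset.mul_sum, ← haa, ← hab', ← hba, ← hbb]
    noncomm_ring
  rw [this]
  exact Finset.sum_nonneg fun k _ => star_mul_self_nonneg _

theorem IsCP.comp {φ ψ : Mat d →ₗ[ℂ] Mat d} (hφ : IsCP φ) (hψ : IsCP ψ) : IsCP (φ ∘ₗ ψ) := by
  obtain ⟨Φ, rfl⟩ := hφ
  obtain ⟨Ψ, rfl⟩ := hψ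
  exact ⟨⟨Φ.toLinearMap ∘ₗ Ψ.toLinearMap, fun k M hM =>
    Φ.map_cstarMatrix_nonneg' k _ (Ψ.map_cstarMatrix_nonneg' k M hM)⟩, rfl⟩

/-- The Kadison–Schwarz inequality for a unital map which is positive after transposition. -/
theorem IsCoCP.schwarz {φ : Mat d →ₗ[ℂ] Mat d} (h : IsCoCP φ) (h1 : IsUnital φ) (X : Mat d) :
    0 ≤ φ (star X * X) - φ X * star (φ X) := by
  have := IsCP.schwarz h (by simp [IsUnital, show φ 1 = 1 from h1]) X
  rw [Matrix.nonneg_iff_posSemidef] at this ⊢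
  have := this.transpose
  rw [Matrix.transpose_sub, Matrix.transpose_mul] at this
  exact this

theorem IsCoCP.comp {φ ψ : Mat d →ₗ[ℂ] Mat d} (hφ : IsCoCP φ) (hψ : IsCP ψ) :
    IsCoCP (φ ∘ₗ ψ) := by
  have := IsCP.comp (ψ := ψ) (φ := _ ∘ₗ φ) hφ hψ
  exact this

/-- A matrix that perturbs a fixed matrix in both directions, by any amount, without destroying
positivity is zero. -/
theorem eq_zero_of_forall_add_smul_nonneg {D H : Mat d} (h : ∀ r : ℝ, 0 ≤ D + r • H) : H = 0 := by
  have aux (K : Mat d) (hK : ∀ n : ℕ, 0 ≤ D + (n : ℝ) • K) : 0 ≤ K := by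
    have hlim : Filter.Tendsto (fun n : ℕ => ((n : ℝ) + 1)⁻¹ • D + K) Filter.atTop
        (nhds ((0 : ℝ) • D + K)) := by
      refine Filter.Tendsto.add (Filter.Tendsto.smul ?_ tendsto_const_nhds) tendsto_const_nhds
      simpa [one_div] using tendsto_one_div_add_atTop_nhds_zero_nat (𝕜 := ℝ)
    rw [zero_smul, zero_add] at hlim
    refine ge_of_tendsto' hlim fun n => ?_
    have hn : (0 : ℝ) < n + 1 := by positivity
    have := smul_nonneg (inv_nonneg.2 hn.le) (hK (n + 1))
    rwa [smul_add, smul_smul, Nat.cast_add, Nat.cast_one, inv_mul_cancel₀ hn.ne', one_smul] at this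
  refine le_antisymm ?_ (aux H fun n => h n)
  refine neg_nonneg.1 (aux (-H) fun n => ?_)
  simpa using h (-n)

/-- Polarisation: equality in a Schwarz inequality propagates to the off-diagonal terms of the
associated positive sesquilinear form. -/
theorem sesq_eq_zero_of_diag_eq_zero (D : Mat d → Mat d → Mat d)
    (hadd : ∀ X Y Z, D (X + Y) Z = D X Z + D Y Z) (hadd' : ∀ X Y Z, D X (Y + Z) = D X Y + D X Z)
    (hsmul : ∀ (c : ℂ) X Y, D (c • X) Y = star c • D X Y)
    (hsmul' : ∀ (c : ℂ) X Y, D X (c • Y) = c • D X Y)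
    (hpos : ∀ X, 0 ≤ D X X) {X : Mat d} (hX : D X X = 0) (Y : Mat d) : D Y X = 0 := by
  have expand (c : ℂ) : 0 ≤ D Y Y + (c • D Y X + star c • D X Y) := by
    have := hpos (Y + c • X)
    simp only [hadd, hadd', hsmul, hsmul', hX, smul_zero, add_zero] at this
    rwa [add_assoc] at this
  have h₁ : D Y X + D X Y = 0 := eq_zero_of_forall_add_smul_nonneg (D := D Y Y) fun r => by
    have := expand r
    simpa [smul_add] using this
  have h₂ : Complex.I • D Y X - Complex.I • D X Y = 0 :=
    eq_zero_of_forall_add_smul_nonneg (D := D Y Y) fun r => by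
    have := expand (r * Complex.I)
    simpa [smul_sub, mul_smul, sub_eq_add_neg] using this
  rw [← smul_sub, smul_eq_zero_iff_right Complex.I_ne_zero, sub_eq_zero] at h₂
  rw [← h₂, ← two_smul ℂ] at h₁
  simpa using h₁

/-- Elements on which the Schwarz inequality is an equality lie in the multiplicative domain. -/
theorem IsCP.map_mul_of_eq {φ : Mat d →ₗ[ℂ] Mat d} (h : IsCP φ) (h1 : IsUnital φ) {X : Mat d}
    (hX : φ (star X * X) = star (φ X) * φ X) (Y : Mat d) : φ (Y * X) = φ Y * φ X := by
  have := sesq_eq_zero_of_diag_eq_zero (fun Y X => φ (star Y * X) - star (φ Y) * φ X)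
    (fun X Y Z => by simp only [star_add, add_mul, map_add]; abel)
    (fun X Y Z => by simp only [mul_add, map_add]; abel)
    (fun c X Y => by simp [smul_sub])
    (fun c X Y => by simp [smul_sub])
    (h.schwarz h1) (sub_eq_zero.2 hX) (star Y)
  simpa [h.map_star, sub_eq_zero] using this

theorem IsCoCP.map_mul_of_eq {φ : Mat d →ₗ[ℂ] Mat d} (h : IsCoCP φ) (h' : IsCP φ)
    (h1 : IsUnital φ) {X : Mat d}
    (hX : φ (star X * X) = φ X * star (φ X)) (Y : Mat d) : φ (Y * X) = φ X * φ Y := by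
  have := sesq_eq_zero_of_diag_eq_zero (fun Y X => φ (star Y * X) - φ X * star (φ Y))
    (fun X Y Z => by simp only [star_add, add_mul, mul_add, map_add]; abel)
    (fun X Y Z => by simp only [mul_add, add_mul, map_add]; abel)
    (fun c X Y => by simp [smul_sub])
    (fun c X Y => by simp [smul_sub])
    (h.schwarz h1) (sub_eq_zero.2 hX) (star Y)
  simpa [h'.map_star, sub_eq_zero] using this

end CompletelyPositive

/-! ### Finite-dimensional reduced commutative algebras. -/

section Idempotents

/-- A finite-dimensional reduced commutative algebra over an algebraically closed field has a basis
of complete orthogonal idempotents. -/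
theorem exists_completeOrthogonalIdempotents_span (k : Type*) {R : Type} [Field k] [IsAlgClosed k]
    [CommRing R] [Algebra k R] [FiniteDimensional k R] [IsReduced R] :
    ∃ (ι : Type) (_ : Fintype ι) (e : ι → R), CompleteOrthogonalIdempotents e ∧
      (∀ i, e i ≠ 0) ∧ ∀ x : R, ∃ c : ι → k, x = ∑ i, c i • e i := by
  classical
  have : IsArtinianRing R := IsArtinianRing.of_finite k R
  let F := IsArtinianRing.equivPi R
  have : Fintype (MaximalSpectrum R) := Fintype.ofFinite _
  -- Residue fields are finite over the algebraically closed `k`, hence equal to it.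
  have hbij (I : MaximalSpectrum R) : Function.Bijective (algebraMap k (R ⧸ I.asIdeal)) := by
    have := I.isMaximal
    have : Algebra.IsIntegral k (R ⧸ I.asIdeal) := inferInstance
    exact IsAlgClosed.algebraMap_bijective_of_isIntegral
  refine ⟨MaximalSpectrum R, inferInstance, fun I => F.symm (Pi.single I 1), ?_, ?_, fun x => ?_⟩
  · exact (CompleteOrthogonalIdempotents.single fun I : MaximalSpectrum R => R ⧸ I.asIdeal).map
      F.symm.toRingEquiv.toRingHom
  · intro I hI
    have := I.isMaximal
    rw [map_eq_zero_iff _ F.symm.injective] at hI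
    have := congrFun hI I
    simp at this
  · choose c hc using fun I => (hbij I).2 (F x I)
    refine ⟨c, F.injective ?_⟩
    ext J
    rw [map_sum, Finset.sum_apply]
    have (I : MaximalSpectrum R) :
        F (c I • F.symm (Pi.single I 1)) J = algebraMap k _ (c I) *
          (Pi.single I 1 : ∀ J : MaximalSpectrum R, R ⧸ J.asIdeal) J := by
      rw [Algebra.smul_def, map_mul, Pi.mul_apply, F.apply_symm_apply]
      rfl
    rw [Finset.sum_congr rfl fun I _ => this I, Finset.sum_eq_single J]
    · simp [hc]
    · intro I _ hI
      rw [Pi.single_eq_of_ne hI.symm, mul_zero]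
    · simp

end Idempotents

/-! ### The norm-preserved star algebra and its commutativity. -/

section Peripheral

open scoped MatrixOrder Matrix.Norms.L2Operator

/-- The square of the Hilbert–Schmidt norm. -/
noncomputable def hsSq (X : Mat d) : ℝ := (star X * X).trace.re

theorem hsSq_eq_sum (X : Mat d) : hsSq X = ∑ i, ∑ j, ‖X j i‖ ^ 2 := by
  simp only [hsSq, Matrix.trace, Matrix.diag, Matrix.mul_apply, Complex.re_sum]
  refine Finset.sum_congr rfl fun i _ => Finset.sum_congr rfl fun j _ => ?_
  rw [Matrix.star_apply, ← Complex.normSq_eq_norm_sq, ← Complex.ofReal_re (Complex.normSq _),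
    Complex.normSq_eq_conj_mul_self]
  rfl

theorem hsSq_nonneg (X : Mat d) : 0 ≤ hsSq X := by
  rw [hsSq_eq_sum]; positivity

theorem norm_apply_sq_le_hsSq (X : Mat d) (i j : Fin d) : ‖X i j‖ ^ 2 ≤ hsSq X := by
  rw [hsSq_eq_sum]
  calc ‖X i j‖ ^ 2 ≤ ∑ k, ‖X k j‖ ^ 2 :=
        Finset.single_le_sum (f := fun k => ‖X k j‖ ^ 2) (fun _ _ => by positivity)
          (Finset.mem_univ i)
    _ ≤ _ := Finset.single_le_sum (f := fun l => ∑ k, ‖X k l‖ ^ 2) (fun _ _ => by positivity)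
          (Finset.mem_univ j)

theorem eq_zero_of_hsSq_eq_zero {X : Mat d} (h : hsSq X = 0) : X = 0 := by
  ext i j
  have := norm_apply_sq_le_hsSq X i j
  rw [h] at this
  simpa using le_antisymm this (sq_nonneg _)

theorem hsSq_star (X : Mat d) : hsSq (star X) = hsSq X := by
  rw [hsSq, star_star, Matrix.trace_mul_comm, hsSq]

theorem trace_re_nonneg {X : Mat d} (h : 0 ≤ X) : 0 ≤ X.trace.re :=
  (Complex.le_def.1 (Matrix.nonneg_iff_posSemidef.1 h).trace_nonneg).1

theorem eq_zero_of_nonneg_of_trace_re {X : Mat d} (h : 0 ≤ X) (h0 : X.trace.re = 0) : X = 0 := by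
  have h' := Matrix.nonneg_iff_posSemidef.1 h
  refine h'.trace_eq_zero_iff.1 (Complex.ext h0 ?_)
  exact (Complex.le_def.1 h'.trace_nonneg).2.symm

/-- A semigroup of unital trace-preserving completely positive maps. -/
structure IsMarkov (φ : ℝ≥0 → (Mat d →ₗ[ℂ] Mat d)) : Prop extends IsSemigroup φ where
  cp : ∀ t, IsCP (φ t)
  unital : ∀ t, IsUnital (φ t)
  tracePreserving : ∀ t, IsTracePreserving (φ t)

variable {φ : ℝ≥0 → (Mat d →ₗ[ℂ] Mat d)}

namespace IsMarkov

theorem apply_add (h : IsMarkov φ) (s t : ℝ≥0) (X : Mat d) : φ (s + t) X = φ s (φ t X) := by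
  rw [h.map_add]; rfl

theorem hsSq_sub (h : IsMarkov φ) (t : ℝ≥0) (X : Mat d) :
    hsSq X - hsSq (φ t X) = (φ t (star X * X) - star (φ t X) * φ t X).trace.re := by
  rw [Matrix.trace_sub, h.tracePreserving, Complex.sub_re, hsSq, hsSq]

theorem hsSq_le (h : IsMarkov φ) (t : ℝ≥0) (X : Mat d) : hsSq (φ t X) ≤ hsSq X := by
  rw [← sub_nonneg, h.hsSq_sub]
  exact trace_re_nonneg ((h.cp t).schwarz (h.unital t) X)

/-- The Schwarz defect is positive, so it vanishes as soon as its trace does. -/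
theorem hsSq_eq_iff (h : IsMarkov φ) (t : ℝ≥0) (X : Mat d) :
    hsSq (φ t X) = hsSq X ↔ φ t (star X * X) = star (φ t X) * φ t X := by
  rw [eq_comm, ← sub_eq_zero, h.hsSq_sub, ← sub_eq_zero (a := φ t _)]
  refine ⟨eq_zero_of_nonneg_of_trace_re ((h.cp t).schwarz (h.unital t) X), fun h => ?_⟩
  rw [h]; simp

theorem map_mul_right (h : IsMarkov φ) (t : ℝ≥0) {X : Mat d} (hX : hsSq (φ t X) = hsSq X)
    (Y : Mat d) : φ t (Y * X) = φ t Y * φ t X :=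
  (h.cp t).map_mul_of_eq (h.unital t) ((h.hsSq_eq_iff t X).1 hX) Y

theorem hsSq_map_star (h : IsMarkov φ) (t : ℝ≥0) {X : Mat d} (hX : hsSq (φ t X) = hsSq X) :
    hsSq (φ t (star X)) = hsSq (star X) := by
  rw [(h.cp t).map_star, hsSq_star, hsSq_star, hX]

theorem map_mul_left (h : IsMarkov φ) (t : ℝ≥0) {X : Mat d} (hX : hsSq (φ t X) = hsSq X)
    (Y : Mat d) : φ t (X * Y) = φ t X * φ t Y := by
  have := congrArg star (h.map_mul_right t (h.hsSq_map_star t hX) (star Y))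
  simpa [← (h.cp t).map_star] using this

/-- The elements whose Hilbert–Schmidt norm is preserved by the whole semigroup form a star
subalgebra. -/
def stable (h : IsMarkov φ) : StarSubalgebra ℂ (Mat d) where
  carrier := {X | ∀ t, hsSq (φ t X) = hsSq X}
  mul_mem' {X Y} hX hY t := by
    rw [h.hsSq_eq_iff, h.map_mul_right t (hY t), star_mul, star_mul]
    rw [show star Y * star X * (X * Y) = star Y * (star X * (X * Y)) by noncomm_ring,
      h.map_mul_left t (h.hsSq_map_star t (hY t)), h.map_mul_left t (h.hsSq_map_star t (hX t)),
      h.map_mul_right t (hY t), (h.cp t).map_star, (h.cp t).map_star]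
    noncomm_ring
  add_mem' {X Y} hX hY t := by
    rw [h.hsSq_eq_iff, star_add, add_mul, mul_add, mul_add]
    simp only [map_add, h.map_mul_right t (hX t), h.map_mul_right t (hY t), star_add, add_mul,
      mul_add, (h.cp t).map_star]
    abel
  algebraMap_mem' c t := by
    rw [Algebra.algebraMap_eq_smul_one, map_smul, show φ t 1 = 1 from h.unital t]
  star_mem' {X} hX t := h.hsSq_map_star t (hX t)

theorem map_mem_stable (h : IsMarkov φ) {X : Mat d} (hX : X ∈ h.stable) (t : ℝ≥0) :
    φ t X ∈ h.stable := fun r => by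
  rw [← h.apply_add, hX, hX]

theorem injOn_stable (h : IsMarkov φ) (t : ℝ≥0) : Set.InjOn (φ t) h.stable := by
  intro X hX Y hY hXY
  have : hsSq _ = hsSq _ := (sub_mem hX hY : X - Y ∈ h.stable) t
  rw [map_sub, hXY, sub_self] at this
  refine sub_eq_zero.1 (eq_zero_of_hsSq_eq_zero (this.symm.trans ?_))
  simp [hsSq]

/-- A completely copositive member of the semigroup turns products with stable elements around. -/
theorem map_mul_comm (h : IsMarkov φ) {s : ℝ≥0} (hs : IsCoCP (φ s)) {X : Mat d}
    (hX : X ∈ h.stable) (Y : Mat d) : φ s (Y * X) = φ s (X * Y) := by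
  have key : φ s (star X * X) - φ s X * star (φ s X) = 0 := by
    refine eq_zero_of_nonneg_of_trace_re (hs.schwarz (h.unital s) X) ?_
    rw [Matrix.trace_sub, h.tracePreserving, Matrix.trace_mul_comm (φ s X), Complex.sub_re,
      sub_eq_zero]
    exact (hX s).symm
  rw [hs.map_mul_of_eq (h.cp s) (h.unital s) (sub_eq_zero.1 key), h.map_mul_left s (hX s)]

/-- Both products have the same image under φ_s, which is injective on stable elements. -/
theorem stable_comm (h : IsMarkov φ) {s : ℝ≥0} (hs : IsCoCP (φ s)) {X Y : Mat d}
    (hX : X ∈ h.stable) (hY : Y ∈ h.stable) : X * Y = Y * X :=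
  h.injOn_stable s (mul_mem hX hY) (mul_mem hY hX) (h.map_mul_comm hs hX Y).symm

end IsMarkov

end Peripheral

/-! ### Stable projections are fixed by the semigroup. -/

section Projections

open scoped MatrixOrder Matrix.Norms.L2Operator

theorem _root_.IsIdempotentElem.star_eq_of_commute {A : Type*} [NonUnitalNormedRing A] [StarRing A]
    [CStarRing A] {p : A} (hp : IsIdempotentElem p) (hc : star p * p = p * star p) :
    star p = p := by
  -- By the C⋆-identity this forces p = p*p, which is self-adjoint.
  have h₁ : star (p - star p * p) * (p - star p * p) = 0 := by
    have e₁ : star p * (star p * p) = star p * p := by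
      rw [← mul_assoc, ← star_mul, hp.eq]
    have e₂ : star p * p * p = star p * p := by rw [mul_assoc, hp.eq]
    have e₃ : star p * p * (star p * p) = star p * p := by
      rw [mul_assoc, ← mul_assoc p, ← hc, e₂, e₁]
    rw [star_sub, star_mul, star_star, sub_mul, mul_sub, mul_sub, e₁, e₂, e₃]
    simp
  have h₂ : p = star p * p := sub_eq_zero.1 ((CStarRing.star_mul_self_eq_zero_iff _).1 h₁)
  calc star p = star (star p * p) := by rw [← h₂]
    _ = p := by rw [star_mul, star_star, ← h₂]

namespace IsMarkov

variable {φ : ℝ≥0 → (Mat d →ₗ[ℂ] Mat d)}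

/-- The stable algebra of a semigroup with a completely copositive member is spanned by mutually
orthogonal projections. -/
theorem exists_projections (h : IsMarkov φ) {s : ℝ≥0} (hs : IsCoCP (φ s)) :
    ∃ (ι : Type) (_ : Fintype ι) (P : ι → Mat d), CompleteOrthogonalIdempotents P ∧
      (∀ i, P i ∈ h.stable) ∧ (∀ i, star (P i) = P i) ∧ (∀ i, P i ≠ 0) ∧
      ∀ X ∈ h.stable, ∃ c : ι → ℂ, X = ∑ i, c i • P i := by
  let _ : CommRing h.stable :=
    { (inferInstance : Ring h.stable) with
      mul_comm := fun X Y => Subtype.ext (h.stable_comm hs X.2 Y.2) }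
  have : IsReduced h.stable := by
    refine (isReduced_iff_pow_one_lt 2 one_lt_two).2 fun X hX => ?_
    have hX' : (X : Mat d) * X = 0 := by
      have := congrArg (Subtype.val) hX
      rwa [pow_two] at this
    -- X is normal, so X² = 0 kills (X*X)²; the C⋆-identity, used twice, then gives X = 0.
    have : star (star (X : Mat d) * X) * (star (X : Mat d) * X) = 0 := by
      rw [star_mul, star_star, h.stable_comm hs (star_mem X.2) X.2, mul_assoc, ← mul_assoc (star _),
        h.stable_comm hs (star_mem X.2) X.2, mul_assoc, ← mul_assoc, hX', zero_mul]
    rw [CStarRing.star_mul_self_eq_zero_iff, CStarRing.star_mul_self_eq_zero_iff] at this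
    exact Subtype.ext this
  have : FiniteDimensional ℂ h.stable := FiniteDimensional.finiteDimensional_subalgebra
    h.stable.toSubalgebra
  obtain ⟨ι, _, e, he, hne, hspan⟩ := exists_completeOrthogonalIdempotents_span ℂ (R := h.stable)
  have heP := he.map h.stable.subtype.toRingHom
  refine ⟨ι, inferInstance, fun i => e i, heP, fun i => (e i).2, fun i => ?_, fun i hi => ?_,
    fun X hX => ?_⟩
  · exact (heP.idem i).star_eq_of_commute (h.stable_comm hs (star_mem (e i).2) (e i).2)
  · exact hne i (Subtype.ext hi)
  · obtain ⟨c, hc⟩ := hspan ⟨X, hX⟩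
    refine ⟨c, ?_⟩
    have := congrArg Subtype.val hc
    simpa using this

/-- In the basis P_i an idempotent has coefficients 0 or 1, so it is a subset sum. -/
theorem finite_idempotents (h : IsMarkov φ) {s : ℝ≥0} (hs : IsCoCP (φ s)) :
    {p | p ∈ h.stable ∧ IsIdempotentElem p}.Finite := by
  classical
  obtain ⟨ι, _, P, hP, -, -, hne, hspan⟩ := h.exists_projections hs
  refine (Set.finite_range fun S : Finset ι => ∑ i ∈ S, P i).subset ?_
  rintro p ⟨hp, hpp⟩
  obtain ⟨c, rfl⟩ := hspan p hp
  have hmul (i : ι) : (∑ j, c j • P j) * P i = c i • P i := by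
    rw [Finset.sum_mul, Finset.sum_eq_single i]
    · rw [smul_mul_assoc, (hP.idem i).eq]
    · intro j _ hj
      rw [smul_mul_assoc, hP.ortho hj, smul_zero]
    · simp
  have hc (i : ι) : c i * c i = c i := by
    have := congrArg (· * P i) hpp.eq
    simp only [mul_assoc, hmul, mul_smul_comm, smul_smul] at this
    exact smul_left_injective ℂ (hne i) this
  refine ⟨Finset.univ.filter fun i => c i = 1, ?_⟩
  simp only [Finset.sum_filter]
  refine Finset.sum_congr rfl fun i _ => ?_
  rcases IsIdempotentElem.iff_eq_zero_or_one.1 (hc i) with h0 | h1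
  · simp [h0]
  · simp [h1]

/-- By divisibility of time, the semigroup acts trivially on the projections it permutes. -/
theorem map_idempotent (h : IsMarkov φ) {s : ℝ≥0} (hs : IsCoCP (φ s)) (t : ℝ≥0) {p : Mat d}
    (hp : p ∈ h.stable) (hpp : IsIdempotentElem p) : φ t p = p := by
  let S : Set (Mat d) := {p | p ∈ h.stable ∧ IsIdempotentElem p}
  have hfin : Finite S := h.finite_idempotents hs
  let f (u : ℝ≥0) (q : S) : S := ⟨φ u q, h.map_mem_stable q.2.1 u, by
    rw [IsIdempotentElem, ← h.map_mul_left u (q.2.1 u), q.2.2.eq]⟩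
  have hf (u : ℝ≥0) : Function.Bijective (f u) := by
    refine Finite.injective_iff_bijective.1 fun q r hqr => Subtype.ext ?_
    exact h.injOn_stable u q.2.1 r.2.1 (congrArg Subtype.val hqr)
  have hiter (u : ℝ≥0) (n : ℕ) (q : S) : ((f u)^[n] q : Mat d) = φ (n * u) q := by
    induction n with
    | zero => simp [h.map_zero]
    | succ n ih =>
      rw [Function.iterate_succ_apply', Nat.cast_succ, add_mul, one_mul, add_comm, h.apply_add, ← ih]
  set N := Nat.card (Equiv.Perm S)
  have hN : (N : ℝ≥0) ≠ 0 := Nat.cast_ne_zero.2 Nat.card_pos.ne'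
  have hpow := pow_card_eq_one' (x := Equiv.ofBijective _ (hf (t / N)))
  have := hiter (t / N) N ⟨p, hp, hpp⟩
  rw [mul_div_cancel₀ _ hN] at this
  rw [← this]
  have h2 := congrArg (fun g : Equiv.Perm S => (g ⟨p, hp, hpp⟩ : Mat d)) hpow
  rw [← Equiv.Perm.iterate_eq_pow] at h2
  exact h2

end IsMarkov

end Projections

/-! ### Convergence to the conditional expectation. -/

section Convergence

open Filter Topology

theorem continuous_hsSq : Continuous (hsSq : Mat d → ℝ) := by
  unfold hsSq; fun_prop

theorem isCompact_hsSq_le (c : ℝ) : IsCompact {X : Mat d | hsSq X ≤ c} := by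
  have hK : IsCompact (Set.pi Set.univ fun _ : Fin d => Set.pi Set.univ fun _ : Fin d =>
      Metric.closedBall (0 : ℂ) √c) :=
    isCompact_univ_pi fun _ => isCompact_univ_pi fun _ => isCompact_closedBall _ _
  refine IsCompact.of_isClosed_subset hK (isClosed_le continuous_hsSq continuous_const) ?_
  intro X hX i _ j _
  rw [mem_closedBall_zero_iff]
  exact Real.le_sqrt_of_sq_le ((norm_apply_sq_le_hsSq X i j).trans hX)

theorem tendsto_zero_of_hsSq {α : Type*} {l : Filter α} {f : α → Mat d}
    (h : Tendsto (fun a => hsSq (f a)) l (𝓝 0)) : Tendsto f l (𝓝 0) := by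
  refine tendsto_pi_nhds.2 fun i => tendsto_pi_nhds.2 fun j => ?_
  refine tendsto_zero_iff_norm_tendsto_zero.2 ?_
  have h2 : Tendsto (fun a => √(hsSq (f a))) l (𝓝 0) := by
    simpa using h.sqrt
  exact squeeze_zero (fun _ => norm_nonneg _)
    (fun a => Real.le_sqrt_of_sq_le (norm_apply_sq_le_hsSq (f a) i j)) h2

/-- A nonzero orthogonal projection has positive trace, bounded by the dimension. -/
theorem exists_trace_eq {p : Mat d} (hp : IsIdempotentElem p) (hs : star p = p) (h0 : p ≠ 0) :
    ∃ r : ℝ, 0 < r ∧ r ≤ d ∧ p.trace = r := by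
  have him : p.trace.im = 0 := by
    have := congrArg Complex.im (congrArg Matrix.trace hs)
    rw [Matrix.star_eq_conjTranspose, Matrix.trace_conjTranspose] at this
    simp at this
    linarith
  have hre : p.trace.re = hsSq p := by rw [hsSq, hs, hp.eq]
  refine ⟨p.trace.re, ?_, ?_, Complex.ext rfl (by simpa using him)⟩
  · rw [hre]
    exact (hsSq_nonneg p).lt_of_ne fun h => h0 (eq_zero_of_hsSq_eq_zero h.symm)
  · have : hsSq (1 - p) = d - p.trace.re := by
      rw [hsSq, star_sub, hs, star_one, hp.one_sub.eq, Matrix.trace_sub]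
      simp
    linarith [hsSq_nonneg (1 - p)]

/-- The conditional expectation onto the span of mutually orthogonal projections. -/
noncomputable def condExp {ι : Type} [Fintype ι] (P : ι → Mat d) :
    Mat d →ₗ[ℂ] Mat d :=
  ∑ i, ((P i).trace⁻¹ • (Matrix.traceLinearMap (Fin d) ℂ ℂ ∘ₗ LinearMap.mulLeft ℂ (P i))).smulRight
    (P i)

theorem condExp_apply {ι : Type} [Fintype ι] (P : ι → Mat d) (X : Mat d) :
    condExp P X = ∑ i, ((P i).trace⁻¹ * (P i * X).trace) • P i := by
  simp [condExp]


variable {ι : Type} [Fintype ι] {P : ι → Mat d}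

theorem condExp_star (hP : ∀ i, star (P i) = P i) (X : Mat d) :
    condExp P (star X) = star (condExp P X) := by
  have ht (Y : Mat d) : (star Y).trace = star Y.trace := Matrix.trace_conjTranspose Y
  rw [condExp_apply, condExp_apply, star_sum]
  refine Finset.sum_congr rfl fun i _ => ?_
  rw [star_smul, hP, star_mul', star_inv₀, ← ht, ← ht, star_mul, hP, Matrix.trace_mul_comm]

namespace IsMarkov

variable {φ : ℝ≥0 → (Mat d →ₗ[ℂ] Mat d)}

theorem condExp_eq_self (h : IsMarkov φ) (hP : CompleteOrthogonalIdempotents P)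
    (hs : ∀ i, star (P i) = P i) (h0 : ∀ i, P i ≠ 0)
    (hspan : ∀ X ∈ h.stable, ∃ c : ι → ℂ, X = ∑ i, c i • P i) {X : Mat d} (hX : X ∈ h.stable) :
    condExp P X = X := by
  classical
  obtain ⟨c, rfl⟩ := hspan X hX
  rw [condExp_apply]
  refine Finset.sum_congr rfl fun i _ => ?_
  have : P i * ∑ j, c j • P j = c i • P i := by
    rw [Finset.mul_sum, Finset.sum_eq_single i]
    · rw [mul_smul_comm, (hP.idem i).eq]
    · intro j _ hj
      rw [mul_smul_comm, hP.ortho hj.symm, smul_zero]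
    · simp
  obtain ⟨r, hr, -, hr'⟩ := exists_trace_eq (hP.idem i) (hs i) (h0 i)
  rw [this, Matrix.trace_smul, hr', smul_eq_mul]
  congr 1
  have : (r : ℂ) ≠ 0 := by exact_mod_cast hr.ne'
  field_simp

theorem condExp_mem (h : IsMarkov φ) (hmem : ∀ i, P i ∈ h.stable) (X : Mat d) :
    condExp P X ∈ h.stable := by
  rw [condExp_apply]
  exact sum_mem fun i _ => h.stable.smul_mem (hmem i) _

/-- Trace preservation and multiplicativity at P_i give tr(P_i φ_t(X)) = tr(φ_t(P_i X)) = tr(P_i X).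
-/
theorem condExp_map (h : IsMarkov φ) (hmem : ∀ i, P i ∈ h.stable)
    (hfix : ∀ t i, φ t (P i) = P i) (t : ℝ≥0) (X : Mat d) :
    condExp P (φ t X) = condExp P X := by
  rw [condExp_apply, condExp_apply]
  refine Finset.sum_congr rfl fun i _ => ?_
  rw [← h.tracePreserving t (P i * X), h.map_mul_left t (hmem i t), hfix]

theorem antitone_hsSq (h : IsMarkov φ) (X : Mat d) : Antitone fun t => hsSq (φ t X) := by
  intro t u htu
  obtain ⟨r, rfl⟩ := exists_add_of_le htu
  change hsSq _ ≤ hsSq _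
  rw [add_comm, h.apply_add]
  exact h.hsSq_le r _

/-- Every limit point of an orbit is stable; hence orbits without stable part tend to zero. -/
theorem tendsto_zero (h : IsMarkov φ) (E : Mat d →ₗ[ℂ] Mat d) (hE : ∀ X ∈ h.stable, E X = X)
    (hEφ : ∀ t X, E (φ t X) = E X) {X : Mat d} (hX : E X = 0) :
    Tendsto (fun t => φ t X) atTop (𝓝 0) := by
  -- Monotonicity yields the limit without any continuity in t.
  have hlim : Tendsto (fun t => hsSq (φ t X)) atTop (𝓝 (⨅ t, hsSq (φ t X))) :=
    tendsto_atTop_ciInf (h.antitone_hsSq X) ⟨0, by rintro _ ⟨t, rfl⟩; exact hsSq_nonneg _⟩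
  set ℓ := ⨅ t, hsSq (φ t X)
  have : FirstCountableTopology (Mat d) :=
    inferInstanceAs (FirstCountableTopology (Fin d → Fin d → ℂ))
  obtain ⟨Z, -, u, hu, hZ⟩ := (isCompact_hsSq_le (hsSq X)).tendsto_subseq
    (x := fun n : ℕ => φ n X) fun n => h.hsSq_le n X
  have hu' : Tendsto (fun n => (u n : ℝ≥0)) atTop atTop :=
    tendsto_natCast_atTop_atTop.comp hu.tendsto_atTop
  have hcont (f : Mat d →ₗ[ℂ] Mat d) : Continuous f := f.continuous_of_finiteDimensional
  have hZt (t : ℝ≥0) : hsSq (φ t Z) = ℓ := by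
    have h1 : Tendsto (fun n => hsSq (φ t (φ (u n) X))) atTop (𝓝 (hsSq (φ t Z))) :=
      ((continuous_hsSq.comp (hcont (φ t))).tendsto Z).comp hZ
    refine tendsto_nhds_unique h1 ?_
    simp only [← h.apply_add]
    exact hlim.comp (tendsto_atTop_mono (fun _ => le_add_self) hu')
  have hZ0 : Z = 0 := by
    have hmem : Z ∈ h.stable := fun t => by
      rw [hZt, ← hZt 0, h.map_zero]; rfl
    rw [← hE Z hmem]
    refine tendsto_nhds_unique (((hcont E).tendsto Z).comp hZ) ?_
    simp [Function.comp_def, hEφ, hX]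
  have hℓ : ℓ = 0 := by
    rw [← hZt 0, hZ0, map_zero]; simp [hsSq]
  rw [hℓ] at hlim
  exact tendsto_zero_of_hsSq hlim

theorem tendsto_condExp (h : IsMarkov φ) (hP : CompleteOrthogonalIdempotents P)
    (hmem : ∀ i, P i ∈ h.stable) (hs : ∀ i, star (P i) = P i) (h0 : ∀ i, P i ≠ 0)
    (hspan : ∀ X ∈ h.stable, ∃ c : ι → ℂ, X = ∑ i, c i • P i)
    (hfix : ∀ t i, φ t (P i) = P i) (X : Mat d) :
    Tendsto (fun t => φ t X - condExp P X) atTop (𝓝 0) := by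
  have hE (X) (hX : X ∈ h.stable) := h.condExp_eq_self hP hs h0 hspan hX
  have hφE (t : ℝ≥0) : φ t (condExp P X) = condExp P X := by
    rw [condExp_apply, map_sum]
    simp [hfix]
  have := h.tendsto_zero (condExp P) hE (h.condExp_map hmem hfix) (X := X - condExp P X)
    (by rw [map_sub, hE _ (h.condExp_mem hmem X), sub_self])
  simpa [hφE] using this

end IsMarkov

end Convergence

/-! ### The Holevo cone near the depolarising map. -/

section Holevo

open Filter Topology
open scoped MatrixOrder Matrix.Norms.L2Operator

/-- The rank-one map `X ↦ tr(A X) B`. -/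
noncomputable def measurePrepare (A B : Mat d) : Mat d →ₗ[ℂ] Mat d :=
  (Matrix.traceLinearMap (Fin d) ℂ ℂ ∘ₗ LinearMap.mulLeft ℂ A).smulRight B

@[simp]
theorem measurePrepare_apply (A B X : Mat d) : measurePrepare A B X = (A * X).trace • B := rfl

/-- The maps of Holevo form `X ↦ ∑ k, tr(A k * X) • B k` with `A k`, `B k` positive semidefinite. -/
def holevo (d : ℕ) : AddSubmonoid (Mat d →ₗ[ℂ] Mat d) :=
  AddSubmonoid.closure {φ | ∃ A B : Mat d, 0 ≤ A ∧ 0 ≤ B ∧ φ = measurePrepare A B}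

theorem measurePrepare_mem_holevo {A B : Mat d} (hA : 0 ≤ A) (hB : 0 ≤ B) :
    measurePrepare A B ∈ holevo d :=
  AddSubmonoid.subset_closure ⟨A, B, hA, hB, rfl⟩

theorem choi_add (φ ψ : Mat d →ₗ[ℂ] Mat d) : choi (φ + ψ) = choi φ + choi ψ := by
  simp only [choi, LinearMap.add_apply, Matrix.kronecker_add, Finset.sum_add_distrib]

theorem choi_measurePrepare (A B : Mat d) : choi (measurePrepare A B) = A.transpose ⊗ₖ B := by
  ext ⟨i, k⟩ ⟨j, l⟩
  simp [choi, Matrix.sum_apply, Matrix.single_apply, Matrix.trace_mul_single, ite_and]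

theorem isSeparable_choi_of_mem_holevo {φ : Mat d →ₗ[ℂ] Mat d} (h : φ ∈ holevo d) :
    IsSeparable (choi φ) := by
  induction h using AddSubmonoid.closure_induction with
  | mem φ hφ =>
    obtain ⟨A, B, hA, hB, rfl⟩ := hφ
    rw [Matrix.nonneg_iff_posSemidef] at hA hB
    exact ⟨1, fun _ => A.transpose, fun _ => B, fun _ => hA.transpose, fun _ => hB, by
      simp [choi_measurePrepare]⟩
  | zero => exact ⟨0, Fin.elim0, Fin.elim0, fun i => i.elim0, fun i => i.elim0, by simp [choi]⟩
  | add φ ψ _ _ h₁ h₂ =>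
    obtain ⟨m, A, B, hA, hB, h₁⟩ := h₁
    obtain ⟨n, A', B', hA', hB', h₂⟩ := h₂
    refine ⟨m + n, Fin.append A A', Fin.append B B', fun i => ?_, fun i => ?_, ?_⟩
    · induction i using Fin.addCases <;> simp [hA, hA']
    · induction i using Fin.addCases <;> simp [hB, hB']
    · simp [choi_add, h₁, h₂, Fin.sum_univ_add]

theorem smul_mem_holevo {φ : Mat d →ₗ[ℂ] Mat d} (h : φ ∈ holevo d) {r : ℝ} (hr : 0 ≤ r) :
    r • φ ∈ holevo d := by
  induction h using AddSubmonoid.closure_induction with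
  | mem φ hφ =>
    obtain ⟨A, B, hA, hB, rfl⟩ := hφ
    have : r • measurePrepare A B = measurePrepare A (r • B) := by
      ext1 X; simp [smul_comm r]
    rw [this]
    exact measurePrepare_mem_holevo hA (smul_nonneg hr hB)
  | zero => simp
  | add φ ψ _ _ h₁ h₂ => rw [smul_add]; exact add_mem h₁ h₂

/-- Maps of Holevo form are stable under compression by a self-adjoint matrix. -/
theorem compress_mem_holevo {φ ψ : Mat d →ₗ[ℂ] Mat d} (h : φ ∈ holevo d) {P : Mat d}
    (hP : star P = P) (hψ : ∀ X, ψ X = P * φ (P * X * P) * P) : ψ ∈ holevo d := by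
  have hc {A : Mat d} (hA : 0 ≤ A) : 0 ≤ P * A * P := by
    have := star_left_conjugate_nonneg hA P
    rwa [hP] at this
  obtain rfl : ψ = LinearMap.mulLeft ℂ P ∘ₗ LinearMap.mulRight ℂ P ∘ₗ φ ∘ₗ LinearMap.mulLeft ℂ P
      ∘ₗ LinearMap.mulRight ℂ P := by
    ext1 X; simp [hψ, mul_assoc]
  clear hψ
  induction h using AddSubmonoid.closure_induction with
  | mem φ hφ =>
    obtain ⟨A, B, hA, hB, rfl⟩ := hφ
    convert measurePrepare_mem_holevo (hc hA) (hc hB) using 1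
    ext1 X
    have : (A * (P * (X * P))).trace = (P * A * P * X).trace := by
      rw [← mul_assoc, ← mul_assoc, Matrix.trace_mul_comm]
      simp only [mul_assoc]
    simp [this, mul_assoc]
  | zero => simp
  | add φ ψ _ _ h₁ h₂ =>
    convert add_mem h₁ h₂ using 1
    ext1 X; simp [mul_add, add_mul]

/-- Near the completely depolarising map, all hermitian rank-one perturbations have Holevo form. -/
theorem measurePrepare_add_mem_holevo {H G : Mat d} (hH : IsSelfAdjoint H)
    (hG : IsSelfAdjoint G) :
    measurePrepare H G + (‖H‖ * ‖G‖) • measurePrepare 1 1 ∈ holevo d := by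
  have key {K : Mat d} (hK : IsSelfAdjoint K) :
      0 ≤ ‖K‖ • (1 : Mat d) + K ∧ 0 ≤ ‖K‖ • (1 : Mat d) - K := by
    have h1 := hK.le_algebraMap_norm_self
    have h2 := hK.neg_algebraMap_norm_le_self
    rw [Algebra.algebraMap_eq_smul_one] at h1 h2
    exact ⟨by rw [add_comm]; exact neg_le_iff_add_nonneg.1 h2, sub_nonneg.2 h1⟩
  -- With a = ‖H‖ and b = ‖G‖, the cross terms cancel in (a+H)⊗(b+G) + (a−H)⊗(b−G) = 2(H⊗G + ab).
  have hmem := smul_mem_holevo (add_mem (measurePrepare_mem_holevo (key hH).1 (key hG).1)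
    (measurePrepare_mem_holevo (key hH).2 (key hG).2)) (r := 1 / 2) (by norm_num)
  convert hmem using 1
  ext1 X
  simp only [LinearMap.add_apply, LinearMap.smul_apply, measurePrepare_apply, add_mul, sub_mul,
    one_mul, Matrix.trace_add, Matrix.trace_sub, smul_mul_assoc, Matrix.trace_smul, smul_add,
    smul_sub, add_smul, sub_smul, Complex.real_smul]
  module

/-- The hermitian matrices `E_ij + E_ji` and `i (E_ij - E_ji)`. -/
noncomputable def hermFrame (d : ℕ) : (Fin d × Fin d) × Bool → Mat d
  | (⟨i, j⟩, false) => Matrix.single i j 1 + Matrix.single j i 1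
  | (⟨i, j⟩, true) => Complex.I • (Matrix.single i j 1 - Matrix.single j i 1)

theorem isSelfAdjoint_hermFrame (a : (Fin d × Fin d) × Bool) : IsSelfAdjoint (hermFrame d a) := by
  obtain ⟨⟨i, j⟩, _ | _⟩ := a
  · simp [IsSelfAdjoint, hermFrame, Matrix.star_eq_conjTranspose, add_comm]
  · simp [IsSelfAdjoint, hermFrame, Matrix.star_eq_conjTranspose, smul_sub]
    ext k l
    simp only [Matrix.sub_apply, Matrix.single_apply]
    split_ifs <;> simp

theorem sum_trace_hermFrame_smul (X : Mat d) :
    (1 / 4 : ℝ) • ∑ a, (hermFrame d a * X).trace • hermFrame d a = X := by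
  have hX : X = ∑ p : Fin d × Fin d, X p.1 p.2 • Matrix.single p.1 p.2 (1 : ℂ) := by
    conv_lhs => rw [Matrix.matrix_eq_sum_single X]
    rw [Fintype.sum_prod_type]
    simp
  have hX' : X = ∑ p : Fin d × Fin d, X p.2 p.1 • Matrix.single p.2 p.1 (1 : ℂ) := by
    conv_lhs => rw [hX]
    exact (Equiv.sum_comp (Equiv.prodComm _ _) _).symm
  -- Summing over ordered pairs counts X twice in each summand, whence the factor 1/4.
  have hterm (p : Fin d × Fin d) : ∑ b, (hermFrame d (p, b) * X).trace • hermFrame d (p, b)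
      = (2 : ℂ) • (X p.1 p.2 • Matrix.single p.1 p.2 (1 : ℂ))
        + (2 : ℂ) • (X p.2 p.1 • Matrix.single p.2 p.1 (1 : ℂ)) := by
    obtain ⟨i, j⟩ := p
    simp only [Fintype.sum_bool, hermFrame, add_mul, sub_mul, smul_mul_assoc, Matrix.trace_add,
      Matrix.trace_smul, Matrix.trace_sub, Matrix.trace_single_mul]
    have : Complex.I * Complex.I = -1 := Complex.I_mul_I
    match_scalars
    · simp only [smul_eq_mul]
      linear_combination (X j i - X i j) * this
    · simp only [smul_eq_mul]
      linear_combination (X i j - X j i) * this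
  rw [Fintype.sum_prod_type, Finset.sum_congr rfl fun p _ => hterm p, Finset.sum_add_distrib,
    ← Finset.smul_sum, ← Finset.smul_sum, ← hX, ← hX']
  module

/-- A hermitian-preserving map, corrected by a multiple of the completely depolarising map, has
Holevo form. -/
theorem add_smul_mem_holevo (Δ : Mat d →ₗ[ℂ] Mat d) (hΔ : ∀ X, Δ (star X) = star (Δ X)) {r : ℝ}
    (hr : (1 / 4) * ∑ a, ‖hermFrame d a‖ * ‖Δ (hermFrame d a)‖ ≤ r) :
    Δ + r • measurePrepare 1 1 ∈ holevo d := by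
  have h₁ := smul_mem_holevo (sum_mem fun a (_ : a ∈ Finset.univ) =>
    measurePrepare_add_mem_holevo (isSelfAdjoint_hermFrame a)
    (show IsSelfAdjoint (Δ (hermFrame d a)) by
      rw [IsSelfAdjoint, ← hΔ, (isSelfAdjoint_hermFrame a).star_eq])) (r := 1 / 4) (by norm_num)
  have h₂ := smul_mem_holevo (measurePrepare_mem_holevo (d := d) zero_le_one zero_le_one)
    (sub_nonneg.2 hr)
  convert add_mem h₁ h₂ using 1
  have : Δ = (1 / 4 : ℝ) • ∑ a, measurePrepare (hermFrame d a) (Δ (hermFrame d a)) := by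
    ext1 X
    conv_lhs => rw [← sum_trace_hermFrame_smul X]
    simp [LinearMap.sum_apply, map_sum]
  rw [Finset.sum_add_distrib, ← Finset.sum_smul, smul_add, ← this]
  module

end Holevo

/-! ### Block decomposition and the final estimate. -/

section EventuallyEB

open Filter Topology
open scoped MatrixOrder Matrix.Norms.L2Operator

namespace IsMarkov

variable {φ : ℝ≥0 → (Mat d →ₗ[ℂ] Mat d)} {ι : Type} [Fintype ι] {P : ι → Mat d}

/-- Completely copositive members of the semigroup are block diagonal for the stable projections. -/
theorem map_eq_sum_compress (h : IsMarkov φ) {t : ℝ≥0} (ht : IsCoCP (φ t))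
    (hP : CompleteOrthogonalIdempotents P) (hmem : ∀ i, P i ∈ h.stable)
    (hfix : ∀ t i, φ t (P i) = P i) (X : Mat d) :
    φ t X = ∑ i, P i * φ t (P i * X * P i) * P i := by
  have hi (i : ι) : φ t (P i * X) = P i * φ t (P i * X * P i) * P i := by
    have hidem := (hP.idem i).eq
    calc φ t (P i * X) = φ t (P i * X * P i) := by
          rw [h.map_mul_comm ht (hmem i), ← mul_assoc, hidem]
      _ = φ t (P i * (P i * X * P i) * P i) := by
          simp only [mul_assoc, hidem, ← mul_assoc (P i) (P i)]
      _ = _ := by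
          rw [h.map_mul_right t (hmem i t), h.map_mul_left t (hmem i t), hfix]
  rw [← Finset.sum_congr rfl fun i _ => hi i, ← map_sum, ← Finset.sum_mul, hP.complete, one_mul]

theorem eventually_mem_holevo (h : IsMarkov φ) {s : ℝ≥0} (hs : ∀ t, s ≤ t → IsCoCP (φ t)) :
    ∀ᶠ t in atTop, φ t ∈ holevo d := by
  classical
  obtain ⟨ι, _, P, hP, hmem, hstar, h0, hspan⟩ := h.exists_projections (hs s le_rfl)
  have hfix (t : ℝ≥0) (i : ι) : φ t (P i) = P i :=
    h.map_idempotent (hs s le_rfl) t (hmem i) (hP.idem i)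
  have hlim : Tendsto (fun t => (1 / 4 : ℝ) * ∑ a, ‖hermFrame d a‖ *
      ‖(φ t - condExp P) (hermFrame d a)‖) atTop (𝓝 0) := by
    have (a : (Fin d × Fin d) × Bool) :
        Tendsto (fun t => ‖(φ t - condExp P) (hermFrame d a)‖) atTop (𝓝 0) :=
      tendsto_zero_iff_norm_tendsto_zero.1
        (h.tendsto_condExp hP hmem hstar h0 hspan hfix (hermFrame d a))
    have := (tendsto_finsetSum Finset.univ fun a _ =>
      (this a).const_mul ‖hermFrame d a‖).const_mul (1 / 4 : ℝ)
    simpa using this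
  -- One threshold for all blocks: tr(P_i) ≤ d. The +1 keeps it positive when d = 0.
  have hpos : (0 : ℝ) < ((d : ℝ) + 1)⁻¹ := by positivity
  filter_upwards [hlim.eventually_le_const hpos, eventually_ge_atTop s] with t htsmall hts
  have hsum : φ t = ∑ i, LinearMap.mulLeft ℂ (P i) ∘ₗ LinearMap.mulRight ℂ (P i) ∘ₗ φ t ∘ₗ
      LinearMap.mulLeft ℂ (P i) ∘ₗ LinearMap.mulRight ℂ (P i) := by
    ext1 X
    rw [h.map_eq_sum_compress (hs t hts) hP hmem hfix X]
    simp [mul_assoc]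
  rw [hsum]
  refine sum_mem fun i _ => ?_
  obtain ⟨r, hr, hrd, htr⟩ := exists_trace_eq (hP.idem i) (hstar i) (h0 i)
  have hr' : ((d : ℝ) + 1)⁻¹ ≤ r⁻¹ := inv_anti₀ hr (by linarith)
  have hΔ (X : Mat d) : (φ t - condExp P) (star X) = star ((φ t - condExp P) X) := by
    simp [(h.cp t).map_star, condExp_star hstar]
  -- On the block of P_i the conditional expectation equals r⁻¹ times the depolarising map after
  -- compression, so the corrected difference compresses to φ_t.
  refine compress_mem_holevo (add_smul_mem_holevo _ hΔ (htsmall.trans hr')) (hstar i) fun X => ?_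
  have hidem := (hP.idem i).eq
  have hE : condExp P (P i * X * P i) = (r : ℂ)⁻¹ • (P i * X * P i).trace • P i := by
    rw [condExp_apply, Finset.sum_eq_single i]
    · simp only [mul_assoc, htr, mul_smul, ← mul_assoc (P i) (P i), hidem]
    · intro j _ hj
      rw [← mul_assoc, ← mul_assoc, hP.ortho hj]
      simp
    · simp
  have hPE : P i * condExp P (P i * X * P i) * P i
      = P i * ((r⁻¹ • measurePrepare 1 1) (P i * X * P i)) * P i := by
    rw [hE]
    simp only [LinearMap.smul_apply, measurePrepare_apply, one_mul, mul_smul_comm, smul_mul_assoc,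
      hidem, mul_one, ← Complex.coe_smul, Complex.ofReal_inv]
  rw [LinearMap.add_apply, mul_add, add_mul, ← hPE, LinearMap.sub_apply, mul_sub, sub_mul,
    sub_add_cancel]
  simp [mul_assoc]

end IsMarkov

end EventuallyEB

end QuantumMaps

theorem mainTheorem7 (d : ℕ) (φ : ℝ≥0 → (QuantumMaps.Mat d →ₗ[ℂ] QuantumMaps.Mat d))
    (hsemi : QuantumMaps.IsSemigroup φ)
    (hCP : ∀ t, QuantumMaps.IsCP (φ t))
    (hunital : ∀ t, QuantumMaps.IsUnital (φ t))
    (htrace : ∀ t, QuantumMaps.IsTracePreserving (φ t))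
    (hPPT : ∃ s : ℝ≥0, 0 < s ∧ QuantumMaps.IsPPT (φ s)) :
    QuantumMaps.IsEventuallyEB φ := by
  obtain ⟨s, hs, hsPPT⟩ := hPPT
  have h : QuantumMaps.IsMarkov φ := ⟨hsemi, hCP, hunital, htrace⟩
  have hco (t : ℝ≥0) (hst : s ≤ t) : QuantumMaps.IsCoCP (φ t) := by
    obtain ⟨r, rfl⟩ := exists_add_of_le hst
    rw [hsemi.map_add]
    exact hsPPT.2.comp (hCP r)
  obtain ⟨t₁, ht₁⟩ := Filter.eventually_atTop.1 (h.eventually_mem_holevo hco)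
  refine ⟨max s t₁, lt_max_of_lt_left hs, fun t ht => ?_⟩
  exact ⟨⟨hCP t, hco t ((le_max_left _ _).trans ht)⟩,
    QuantumMaps.isSeparable_choi_of_mem_holevo (ht₁ t ((le_max_right _ _).trans ht))⟩
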